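/- Let $A\in\mathbb R^{n_x\times n_x}$, $B\in\mathbb R^{n_x\times n_u}$, $E\in\mathbb R^{n_x\times n_w}$, $C\in\mathbb R^{n_y\times n_x}$, $D\in\mathbb R^{n_y\times n_u}$, $F\in\mathbb R^{n_y\times n_v}$, and consider the discrete-time linear system $$x(t+1)=f(x(t),u(t),w(t)),\qquad y(t)=h(x(t),u(t),v(t)),\qquad t\in\mathbb N=\{0,1,2,\dots\},$$ $$f(x,u,w)=Ax+Bu+Ew,\qquad h(x,u,v)=Cx+Du+Fv,$$ with all spaces carrying the Euclidean norm $\|\cdot\|$. A tuple of sequences $(x,u,w,v,y)$ satisfying both equations for all $t\in\mathbb N$ is called a solution. *Definitions.* The system is *detectable* if every sequence with $x(t+1)=Ax(t)$ and $Cx(t)=0$ for all $t$ satisfies $x(t)\to0$. A function $\alpha:[0,\infty)\to[0,\infty)$ is of class $\mathcal K$ if it is continuous, strictly increasing and $\alpha(0)=0$; $\beta:[0,\infty)\times\mathbb N\to[0,\infty)$ is of class $\mathcal{KL}$ if $\beta(\cdot,t)\in\mathcal K$ for each $t$ and $\beta(r,\cdot)$ is non-increasing with limit $0$ for each $r$.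 The system is *time-discounted i-IOSS* if there are $\beta,\gamma,\delta,\epsilon,\varphi\in\mathcal{KL}$ such that for any two solutions $(x,u,w,v,y)$, $(\chi,\upsilon,\omega,\nu,\zeta)$ and all $t\in\mathbb N$ $$\|x(t)-\chi(t)\|\le\max\Big\{\beta(\|x(0)-\chi(0)\|,t),\ \max_{1\le\tau\le t}\max\big\{\gamma(\|w(t-\tau)-\omega(t-\tau)\|,\tau),\ \delta(\|v(t-\tau)-\nu(t-\tau)\|,\tau),\ \epsilon(\|u(t-\tau)-\upsilon(t-\tau)\|,\tau),\ \varphi(\|y(t-\tau)-\zeta(t-\tau)\|,\tau)\big\}\Big\},$$ where for $t=0$ the empty maximum is omitted. A function $V:\mathbb R^{n_x}\times\mathbb R^{n_x}\to\mathbb R$ *satisfies the Lyapunov inequalities* with $\alpha_1,\alpha_2,\alpha_3,\rho_w,\rho_v,\rho_u,\rho_y:[0,\infty)\to[0,\infty)$ if for all arguments $$\alpha_1(\|x-\chi\|)\le V(x,\chi)\le\alpha_2(\|x-\chi\|),$$ $$V(f(x,u,w),f(\chi,\upsilon,\omega))\le V(x,\chi)-\alpha_3(V(x,\chi))+\rho_w(\|w-\omega\|)+\rho_v(\|v-\nu\|)+\rho_u(\|u-\upsilon\|)+\rho_y(\|h(x,u,v)-h(\chi,\upsilon,\nu)\|);$$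 it is an *i-IOSS Lyapunov function* if it is continuous and satisfies them with some seven functions of class $\mathcal K$. For symmetric positive definite $P$ let $\|x\|_P=\sqrt{x^\top Px}=\|P^{1/2}x\|$, with induced operator norm $\|M\|_P$. A square real matrix is *Schur stable* if all its complex eigenvalues have modulus $<1$. $\lambda_{\max}$ denotes the largest eigenvalue of a symmetric matrix ($0$ for the empty matrix). *Theorem.* 1. The system is detectable if and only if it is time-discounted i-IOSS. 2. If the system is detectable, then there are $L\in\mathbb R^{n_x\times n_y}$ and symmetric positive definite $P,Q\in\mathbb R^{n_x\times n_x}$ such that $A_L:=A+LC$ is Schur stable and $A_L^\top PA_L=P-Q$. 3. For any $L\in\mathbb R^{n_x\times n_y}$ and any symmetric positive definite $P,Q$ with $A_L^\top PA_L=P-Q$, where $A_L=A+LC$ and $B_L:=B+LD$, one has $\|A_L\|_P<1$, and there are constants $a_1,a_2>0$ such that $V(x,\chi)=\|x-\chi\|_P$ satisfies the Lyapunov inequalities with the linear functions $\alpha_1(r)=a_1r$, $\alpha_2(r)=a_2r$, $\alpha_3(r)=(1-\|A_L\|_P)\,r$ and $$\rho_w(r)=\sqrt{\lambda_{\max}(E^\top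 PE)}\,r,\quad \rho_v(r)=\sqrt{\lambda_{\max}((LF)^\top P(LF))}\,r,\quad \rho_u(r)=\sqrt{\lambda_{\max}(B_L^\top PB_L)}\,r,\quad \rho_y(r)=\sqrt{\lambda_{\max}(L^\top PL)}\,r.$$ Here $\rho_w$, $\rho_v$, $\rho_u$, $\rho_y$ is of class $\mathcal K$ whenever $E\ne0$, $LF\ne0$, $B_L\neq0$, $L\ne0$, respectively. Moreover, $V$ is an i-IOSS Lyapunov function, and the system is time-discounted i-IOSS. -/

import Mathlib

open scoped NNReal Matrix Topology
open Filter

/-- Comparison functions of class `𝒦`. -/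
structure ClassK (α : ℝ≥0 → ℝ≥0) : Prop where
  continuous : Continuous α
  strictMono : StrictMono α
  zero : α 0 = 0

/-- Comparison functions of class `ℒ` (discrete time). -/
structure ClassL (α : ℕ → ℝ≥0) : Prop where
  antitone : Antitone α
  tendsto_zero : Tendsto α atTop (𝓝 0)

/-- Comparison functions of class `𝒦ℒ` (discrete time). -/
structure ClassKL (β : ℝ≥0 → ℕ → ℝ≥0) : Prop where
  classK : ∀ t, ClassK (fun r => β r t)
  classL : ∀ r, ClassL (β r)

section Systems

variable {X U W V Y : Type*}

/-- `(x, u, w, v, y)` is a solution of `x(t+1) = f(x(t), u(t), w(t))`, `y(t) = h(x(t), u(t), v(t))`. -/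
structure IsSolution (f : X → U → W → X) (h : X → U → V → Y)
    (x : ℕ → X) (u : ℕ → U) (w : ℕ → W) (v : ℕ → V) (y : ℕ → Y) : Prop where
  state : ∀ t, x (t + 1) = f (x t) (u t) (w t)
  output : ∀ t, y t = h (x t) (u t) (v t)

variable [MetricSpace X] [MetricSpace U] [MetricSpace W] [MetricSpace V] [MetricSpace Y]

/-- Time-discounted incremental input/output-to-state stability, in max-form.  At `t = 0` the
maximum over `1 ≤ τ ≤ t` is empty and does not contribute (it is `0` in `ℝ≥0`). -/
def TimeDiscountedIIOSS (f : X → U → W → X) (h : X → U → V → Y) : Prop :=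
  ∃ β γ δ ε φ : ℝ≥0 → ℕ → ℝ≥0,
    ClassKL β ∧ ClassKL γ ∧ ClassKL δ ∧ ClassKL ε ∧ ClassKL φ ∧
    ∀ (x χ : ℕ → X) (u υ : ℕ → U) (w ω : ℕ → W) (v ν : ℕ → V) (y ζ : ℕ → Y),
      IsSolution f h x u w v y → IsSolution f h χ υ ω ν ζ →
      ∀ t : ℕ, nndist (x t) (χ t) ≤
        max (β (nndist (x 0) (χ 0)) t)
          ((Finset.Icc 1 t).sup fun τ =>
            max (γ (nndist (w (t - τ)) (ω (t - τ))) τ)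
              (max (δ (nndist (v (t - τ)) (ν (t - τ))) τ)
                (max (ε (nndist (u (t - τ)) (υ (t - τ))) τ)
                  (φ (nndist (y (t - τ)) (ζ (t - τ))) τ))))

/-- The inequalities of the i-IOSS Lyapunov condition for a function `S` of two states.
(The upper and lower bounds force `S ≥ 0`, so that `Real.toNNReal` does not change the value.) -/
structure LyapunovCondition (f : X → U → W → X) (h : X → U → V → Y) (S : X × X → ℝ)
    (α₁ α₂ α₃ ρw ρv ρu ρy : ℝ≥0 → ℝ≥0) : Prop where
  lower : ∀ x χ, (α₁ (nndist x χ) : ℝ) ≤ S (x, χ)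
  upper : ∀ x χ, S (x, χ) ≤ α₂ (nndist x χ)
  decrease : ∀ (x χ : X) (u υ : U) (w ω : W) (v ν : V),
    S (f x u w, f χ υ ω) ≤ S (x, χ) - α₃ (S (x, χ)).toNNReal
      + ρw (nndist w ω) + ρv (nndist v ν) + ρu (nndist u υ)
      + ρy (nndist (h x u v) (h χ υ ν))

/-- `S` is an i-IOSS Lyapunov function: it is continuous and satisfies the i-IOSS Lyapunov
condition for some functions of class `𝒦`. -/
def IsIIOSSLyapunovFunction (f : X → U → W → X) (h : X → U → V → Y) (S : X × X → ℝ) : Prop :=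
  Continuous S ∧ ∃ α₁ α₂ α₃ ρw ρv ρu ρy : ℝ≥0 → ℝ≥0,
    ClassK α₁ ∧ ClassK α₂ ∧ ClassK α₃ ∧ ClassK ρw ∧ ClassK ρv ∧ ClassK ρu ∧ ClassK ρy ∧
    LyapunovCondition f h S α₁ α₂ α₃ ρw ρv ρu ρy

end Systems

section Linear

variable {nx nu nw nv ny : ℕ}

/-- The linear state map `f(x, u, w) = A x + B u + E w`. -/
noncomputable def linState (A : Matrix (Fin nx) (Fin nx) ℝ) (B : Matrix (Fin nx) (Fin nu) ℝ)
    (E : Matrix (Fin nx) (Fin nw) ℝ) (x : EuclideanSpace ℝ (Fin nx))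
    (u : EuclideanSpace ℝ (Fin nu)) (w : EuclideanSpace ℝ (Fin nw)) :
    EuclideanSpace ℝ (Fin nx) :=
  Matrix.toEuclideanLin A x + Matrix.toEuclideanLin B u + Matrix.toEuclideanLin E w

/-- The linear output map `h(x, u, v) = C x + D u + F v`. -/
noncomputable def linOutput (C : Matrix (Fin ny) (Fin nx) ℝ) (D : Matrix (Fin ny) (Fin nu) ℝ)
    (F : Matrix (Fin ny) (Fin nv) ℝ) (x : EuclideanSpace ℝ (Fin nx))
    (u : EuclideanSpace ℝ (Fin nu)) (v : EuclideanSpace ℝ (Fin nv)) :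
    EuclideanSpace ℝ (Fin ny) :=
  Matrix.toEuclideanLin C x + Matrix.toEuclideanLin D u + Matrix.toEuclideanLin F v

/-- Detectability of the pair `(A, C)`: every unforced trajectory with identically vanishing
output converges to the origin. -/
def Detectable (A : Matrix (Fin nx) (Fin nx) ℝ) (C : Matrix (Fin ny) (Fin nx) ℝ) : Prop :=
  ∀ x : ℕ → EuclideanSpace ℝ (Fin nx),
    (∀ t, x (t + 1) = Matrix.toEuclideanLin A (x t)) →
    (∀ t, Matrix.toEuclideanLin C (x t) = 0) →
    Tendsto x atTop (𝓝 0)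

/-- Schur stability: all complex eigenvalues lie in the open unit disc. -/
def SchurStable (M : Matrix (Fin nx) (Fin nx) ℝ) : Prop :=
  ∀ μ ∈ spectrum ℂ (M.map Complex.ofReal), ‖μ‖ < 1

/-- Largest real eigenvalue of a (symmetric) matrix; `0` for the empty matrix. -/
noncomputable def lambdaMax {n : ℕ} (M : Matrix (Fin n) (Fin n) ℝ) : ℝ :=
  sSup (spectrum ℝ M)

/-- The weighted norm `‖x‖_P = √(xᵀ P x)`, which is `‖P^{1/2} x‖` for `P` positive definite. -/
noncomputable def weightedNorm (P : Matrix (Fin nx) (Fin nx) ℝ)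
    (x : EuclideanSpace ℝ (Fin nx)) : ℝ :=
  √(x.ofLp ⬝ᵥ (P *ᵥ x.ofLp))

/-- The operator norm `‖M‖_P` of a matrix induced by the weighted norm `‖·‖_P`. -/
noncomputable def weightedOpNorm (P M : Matrix (Fin nx) (Fin nx) ℝ) : ℝ :=
  sInf {c : ℝ | 0 ≤ c ∧
    ∀ x, weightedNorm P (Matrix.toEuclideanLin M x) ≤ c * weightedNorm P x}

/-- The linear function `r ↦ c r` on `[0, ∞)` for a constant `c ≥ 0`. -/
noncomputable def linGain (c : ℝ) (r : ℝ≥0) : ℝ≥0 := c.toNNReal * r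

end Linear

/-!
The heart of the matter is that a detectable pair `(A, C)` admits an output injection `L` for which
`A + L C` is stable. A map of the form `A + L C` is exactly a map that agrees with `A` on `ker C`,
and detectability says that the trajectories of `A` which stay in `ker C` tend to zero. So the
question becomes whether a partially defined linear map `A : K → V` with this trajectory property
extends to a stable endomorphism of `V`. This is `LinearMap.exists_eq_on_tendsto_pow_zero`, proved
by induction on the dimension and without any canonical form or Riccati equation. A finite sum of
Gram matrices of powers then solves the Lyapunov equation
(`Matrix.exists_posDef_lyapunov_of_tendsto_pow_zero`).

Any solution `P`, `Q` of the Lyapunov equation for `A + L C` makes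
`A + L C` a strict contraction for `‖·‖_P` (`weightedOpNorm_lt_one`). Adding and subtracting `L`
times the difference of the outputs in the error dynamics gives the Lyapunov inequalities for the
weighted norm with linear gains (`lyapunovCondition_weightedNorm`). Such a Lyapunov function obeys a
scalar recursion `W(t+1) ≤ c W(t) + a(t)` with `c < 1`, which is solved in max-form by giving up a
little of the decay rate (`le_mul_of_le_mul_add`); this is time-discounted i-IOSS with exponential
discounting (`LyapunovCondition.timeDiscountedIIOSS_of_linGain`). Detectability is recovered from
i-IOSS by comparing with the zero solution (`TimeDiscountedIIOSS.detectable`).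
-/

/-! ### Stabilization by output injection and the Lyapunov equation -/

/-- A linear map `A` defined on a subspace `K` of `V`, all of whose infinite trajectories inside `K`
tend to zero, extends to a linear map on `V` whose powers tend to zero. The induction passes from
`A : K → V` to its restriction `{x ∈ K | A x ∈ K} → K`, whose trajectories are again trajectories
of `A`. Its stable extension `T' : K → K` is then corrected: for a suitable projection `π` onto `K`
one has `π A = T'` on `K`, so `A π` extends `A` and `(A π) ^ (t + 1) = A T' ^ t π`. -/
theorem LinearMap.exists_eq_on_tendsto_pow_zero {V : Type*} [NormedAddCommGroup V]
    [NormedSpace ℝ V] [FiniteDimensional ℝ V] (K : Submodule ℝ V) (A : K →ₗ[ℝ] V)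
    (hA : ∀ x : ℕ → K, (∀ t, (x (t + 1) : V) = A (x t)) → Tendsto x atTop (𝓝 0)) :
    ∃ T : V →ₗ[ℝ] V, (∀ k : K, T k = A k) ∧
      ∀ x, Tendsto (fun t : ℕ => (T ^ t) x) atTop (𝓝 0) := by
  induction hn : Module.finrank ℝ V using Nat.strong_induction_on generalizing V with
  | _ n ih =>
  by_cases hK : K = ⊤
  · subst hK
    let T : V →ₗ[ℝ] V := A ∘ₗ (Submodule.topEquiv (R := ℝ) (M := V)).symm.toLinearMap
    refine ⟨T, fun k => rfl, fun x => ?_⟩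
    have h := hA (fun t => ⟨(T ^ t) x, trivial⟩) fun t => by
      simp only [pow_succ', Module.End.mul_apply]; rfl
    simpa [Function.comp_def] using (continuous_subtype_val.tendsto _).comp h
  · let K' : Submodule ℝ K := K.comap A
    let A' : K' →ₗ[ℝ] K := (A.domRestrict K').codRestrict K fun x => x.2
    obtain ⟨T', hT', hlim⟩ := ih (Module.finrank ℝ K)
      (hn ▸ Submodule.finrank_lt hK) K' A' (fun x hx => by
        have h := hA (fun t => (x t : K)) fun t => congrArg Subtype.val (hx t)
        exact tendsto_subtype_rng.2 h) rfl
    let G : K →ₗ[ℝ] V := A - K.subtype ∘ₗ T'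
    -- the range of `G` meets `K` trivially: `G x ∈ K` forces `x ∈ K'`, where `T'` agrees with `A`
    have hG : ∀ x : K, G x ∈ K → G x = 0 := fun x hx => by
      have hAx : A x ∈ K := by
        have := K.add_mem hx (T' x).2
        simpa [G] using this
      have := congrArg Subtype.val (hT' ⟨x, hAx⟩)
      simp only [G, LinearMap.sub_apply, LinearMap.comp_apply, Submodule.subtype_apply]
      rw [this]; exact sub_self _
    -- hence `K` embeds into `V ⧸ range G`, and a left inverse gives a projection killing `range G`
    obtain ⟨g, hg⟩ := ((LinearMap.range G).mkQ ∘ₗ K.subtype).exists_leftInverse_of_injective (by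
      rw [LinearMap.ker_eq_bot']
      intro k hk
      obtain ⟨x, hx⟩ : (k : V) ∈ LinearMap.range G := by simpa using hk
      have := hG x (hx ▸ k.2)
      exact Subtype.ext (hx.symm.trans this))
    let π : V →ₗ[ℝ] K := g ∘ₗ (LinearMap.range G).mkQ
    have hπK : ∀ k : K, π k = k := fun k => LinearMap.congr_fun hg k
    have hπA : ∀ k : K, π (A k) = T' k := fun k => by
      have h1 : A k = G k + (T' k : V) := by simp [G]
      have h2 : π (G k) = 0 := by
        have : (LinearMap.range G).mkQ (G k) = 0 := by simp
        simp only [π, LinearMap.comp_apply, this, map_zero]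
      rw [h1, map_add, h2, hπK, zero_add]
    refine ⟨A ∘ₗ π, fun k => by simp [hπK], fun x => ?_⟩
    have hpow : ∀ t : ℕ, ((A ∘ₗ π) ^ (t + 1)) x = A ((T' ^ t) (π x)) := fun t => by
      induction t with
      | zero => simp
      | succ t iht =>
        rw [pow_succ', Module.End.mul_apply, iht, LinearMap.comp_apply, hπA, pow_succ',
          Module.End.mul_apply]
    rw [← tendsto_add_atTop_iff_nat 1]
    simp only [hpow]
    have := (A.continuous_of_finiteDimensional.tendsto 0).comp (hlim (π x))
    simpa [Function.comp_def] using this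

/-- Detectability yields an output injection that makes the error dynamics stable: a stable map that
agrees with `A` on `ker C` differs from `A` by a map of the form `L C`. -/
theorem Detectable.exists_tendsto_pow_zero {nx ny : ℕ} {A : Matrix (Fin nx) (Fin nx) ℝ}
    {C : Matrix (Fin ny) (Fin nx) ℝ} (h : Detectable A C) :
    ∃ L : Matrix (Fin nx) (Fin ny) ℝ,
      Tendsto (fun t : ℕ => (A + L * C) ^ t) atTop (𝓝 0) := by
  obtain ⟨T, hTA, hT⟩ := LinearMap.exists_eq_on_tendsto_pow_zero
    (LinearMap.ker (Matrix.toLin' C)) ((Matrix.toLin' A).domRestrict _) (fun x hx => by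
      have := h (fun t => WithLp.toLp 2 (x t : Fin nx → ℝ)) (fun t => by
          simp only [hx]; rfl)
        (fun t => by
          have := (x t).2
          rw [LinearMap.mem_ker] at this
          rw [Matrix.toLpLin_toLp, this]; rfl)
      rw [tendsto_subtype_rng]
      exact ((PiLp.continuous_ofLp 2 _).tendsto _).comp this)
  -- `T - A` vanishes on `ker C`, hence factors through `C`
  obtain ⟨g, hg⟩ : ∃ g : (Fin ny → ℝ) →ₗ[ℝ] (Fin nx → ℝ),
      g ∘ₗ Matrix.toLin' C = T - Matrix.toLin' A := by
    have hker : LinearMap.ker (Matrix.toLin' C) ≤ LinearMap.ker (T - Matrix.toLin' A) :=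
      fun x hx => by
        have := hTA ⟨x, hx⟩
        rw [LinearMap.mem_ker, LinearMap.sub_apply, sub_eq_zero]
        exact this
    obtain ⟨g, hg⟩ := ((LinearMap.ker (Matrix.toLin' C)).liftQ _ hker ∘ₗ
      (Matrix.toLin' C).quotKerEquivRange.symm.toLinearMap).exists_extend
    refine ⟨g, LinearMap.ext fun x => ?_⟩
    have := LinearMap.congr_fun hg ⟨Matrix.toLin' C x, x, rfl⟩
    refine Eq.trans this ?_
    have h2 : (Matrix.toLin' C).quotKerEquivRange.symm ⟨Matrix.toLin' C x, x, rfl⟩ =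
        (LinearMap.ker (Matrix.toLin' C)).mkQ x :=
      (Matrix.toLin' C).quotKerEquivRange_symm_apply_image x ⟨x, rfl⟩
    simp only [LinearMap.comp_apply, LinearEquiv.coe_coe, h2]
    rfl
  refine ⟨LinearMap.toMatrix' g, ?_⟩
  have hM : Matrix.toLin' (A + LinearMap.toMatrix' g * C) = T := by
    rw [map_add, Matrix.toLin'_mul, Matrix.toLin'_toMatrix', hg]; abel
  refine tendsto_pi_nhds.2 fun i => tendsto_pi_nhds.2 fun j => ?_
  have := ((continuous_apply i).tendsto _).comp (hT (Pi.single j 1))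
  refine this.congr fun t => ?_
  rw [Function.comp_apply, ← hM, ← Matrix.toLin'_pow, Matrix.toLin'_apply,
    Matrix.mulVec_single_one]
  rfl

theorem SchurStable.of_tendsto_pow_zero {n : ℕ} {M : Matrix (Fin n) (Fin n) ℝ}
    (hM : Tendsto (fun t : ℕ => M ^ t) atTop (𝓝 0)) : SchurStable M := by
  intro μ hμ
  rw [← Matrix.spectrum_toLin', ← Module.End.hasEigenvalue_iff_mem_spectrum] at hμ
  obtain ⟨z, hz⟩ := hμ.exists_hasEigenvector
  obtain ⟨i, hi⟩ := Function.ne_iff.1 hz.2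
  have hpow : ∀ t : ℕ, (M.map Complex.ofReal) ^ t *ᵥ z = μ ^ t • z := fun t => by
    rw [← Matrix.toLin'_apply, Matrix.toLin'_pow, hz.pow_apply]
  have h1 : Tendsto (fun t : ℕ => (M ^ t).map Complex.ofReal *ᵥ z) atTop (𝓝 0) := by
    have hc : Continuous fun N : Matrix (Fin n) (Fin n) ℝ => N.map Complex.ofReal *ᵥ z := by
      fun_prop
    have := (hc.tendsto 0).comp hM
    simpa [Function.comp_def] using this
  have h2 : Tendsto (fun t : ℕ => μ ^ t) atTop (𝓝 0) := by
    have h3 := (((continuous_apply i).tendsto _).comp h1).mul_const (z i)⁻¹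
    simp only [Pi.zero_apply, zero_mul] at h3
    refine h3.congr fun t => ?_
    have : (M ^ t).map Complex.ofReal = (M.map Complex.ofReal) ^ t :=
      map_pow Complex.ofRealHom.mapMatrix M t
    rw [Function.comp_apply, this, hpow, Pi.smul_apply, smul_eq_mul, mul_assoc,
      mul_inv_cancel₀ hi, mul_one]
  exact tendsto_pow_atTop_nhds_zero_iff_norm_lt_one.1 h2

/-- The discrete Lyapunov equation, solved by a finite sum: if `‖M ^ m‖ < 1` with `m ≥ 1`, then
`P = ∑ t < m, (M ^ t)ᵀ M ^ t` telescopes to `P - Mᵀ P M = 1 - (M ^ m)ᵀ M ^ m`. -/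
theorem Matrix.exists_posDef_lyapunov_of_tendsto_pow_zero {n : ℕ} {M : Matrix (Fin n) (Fin n) ℝ}
    (hM : Tendsto (fun t : ℕ => M ^ t) atTop (𝓝 0)) :
    ∃ P Q : Matrix (Fin n) (Fin n) ℝ, P.PosDef ∧ Q.PosDef ∧ Mᵀ * P * M = P - Q := by
  -- the passage from a matrix to its Euclidean operator, continuous by finite dimensionality
  let Φ := (Matrix.toEuclideanLin (𝕜 := ℝ) (m := Fin n) (n := Fin n)).trans
    LinearMap.toContinuousLinearMap
  have hΦ : Continuous Φ := Φ.toLinearMap.continuous_of_finiteDimensional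
  have h0 : Tendsto (fun t : ℕ => ‖Φ (M ^ t)‖) atTop (𝓝 0) := by
    have := ((hΦ.norm).tendsto 0).comp hM
    simpa [Function.comp_def] using this
  obtain ⟨m, hm, hm1⟩ := ((h0.eventually_lt_const one_pos).and (eventually_ge_atTop 1)).exists
  let P : Matrix (Fin n) (Fin n) ℝ := ∑ t ∈ Finset.range m, (M ^ t)ᵀ * M ^ t
  let Q : Matrix (Fin n) (Fin n) ℝ := 1 - (M ^ m)ᵀ * M ^ m
  have key : Mᵀ * P * M = P - Q := by
    have : Mᵀ * P * M = ∑ t ∈ Finset.range m, (M ^ (t + 1))ᵀ * M ^ (t + 1) := by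
      simp only [P, Finset.mul_sum, Finset.sum_mul, pow_succ, Matrix.transpose_mul,
        Matrix.mul_assoc]
    rw [this]
    have h1 := Finset.sum_range_succ (fun t => (M ^ t)ᵀ * M ^ t) m
    have h2 := Finset.sum_range_succ' (fun t => (M ^ t)ᵀ * M ^ t) m
    simp only [pow_zero, Matrix.transpose_one, one_mul] at h2
    simp only [P, Q]
    rw [sub_sub_eq_add_sub, ← h1, h2]; abel
  refine ⟨P, Q, ?_, ?_, key⟩
  · obtain ⟨k, rfl⟩ : ∃ k, m = k + 1 := ⟨m - 1, by omega⟩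
    simp only [P, Finset.sum_range_succ', pow_zero, Matrix.transpose_one, one_mul]
    exact Matrix.PosDef.posSemidef_add (Matrix.posSemidef_sum _ fun t _ =>
      Matrix.posSemidef_conjTranspose_mul_self (M ^ (t + 1))) Matrix.PosDef.one
  · refine Matrix.PosDef.of_dotProduct_mulVec_pos ?_ fun x hx => ?_
    · exact Matrix.isHermitian_one.sub (Matrix.isHermitian_conjTranspose_mul_self (M ^ m))
    · have h1 : ‖Φ (M ^ m) (WithLp.toLp 2 x)‖ < ‖WithLp.toLp 2 x‖ := by
        have hx0 : 0 < ‖WithLp.toLp 2 x‖ := by simpa using hx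
        calc _ ≤ ‖Φ (M ^ m)‖ * ‖WithLp.toLp 2 x‖ := (Φ (M ^ m)).le_opNorm _
          _ < 1 * ‖WithLp.toLp 2 x‖ := by gcongr
          _ = _ := one_mul _
      have h2 := pow_lt_pow_left₀ h1 (norm_nonneg _) two_ne_zero
      rw [← real_inner_self_eq_norm_sq, ← real_inner_self_eq_norm_sq,
        EuclideanSpace.inner_eq_star_dotProduct, EuclideanSpace.inner_eq_star_dotProduct] at h2
      have h3 : (Φ (M ^ m) (WithLp.toLp 2 x)).ofLp = M ^ m *ᵥ x := rfl
      rw [h3] at h2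
      simp only [star_trivial] at h2 ⊢
      rw [Matrix.sub_mulVec, dotProduct_sub, Matrix.one_mulVec, ← Matrix.mulVec_mulVec,
        Matrix.dotProduct_mulVec, Matrix.vecMul_transpose]
      linarith

/-! ### The weighted norm and its operator norm -/

theorem dotProduct_mulVec_le_lambdaMax {n : ℕ} {M : Matrix (Fin n) (Fin n) ℝ}
    (hM : M.IsHermitian) (x : EuclideanSpace ℝ (Fin n)) :
    x.ofLp ⬝ᵥ (M *ᵥ x.ofLp) ≤ lambdaMax M * ‖x‖ ^ 2 := by
  have h : (algebraMap ℝ (Matrix (Fin n) (Fin n) ℝ) (lambdaMax M) - M).PosSemidef := by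
    rw [Matrix.posSemidef_iff_isHermitian_and_spectrum_nonneg]
    constructor
    · refine Matrix.IsHermitian.sub ?_ hM
      rw [Algebra.algebraMap_eq_smul_one, Matrix.IsHermitian, Matrix.conjTranspose_smul]
      simp
    · rw [← spectrum.singleton_sub_eq]
      rintro _ ⟨_, rfl, μ, hμ, rfl⟩
      exact sub_nonneg.2 (le_csSup M.finite_real_spectrum.bddAbove hμ)
  have h1 := h.dotProduct_mulVec_nonneg x.ofLp
  rw [Algebra.algebraMap_eq_smul_one, Matrix.sub_mulVec, Matrix.smul_mulVec, Matrix.one_mulVec,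
    dotProduct_sub, dotProduct_smul, star_trivial, smul_eq_mul] at h1
  have h2 : ‖x‖ ^ 2 = x.ofLp ⬝ᵥ x.ofLp := by
    rw [← real_inner_self_eq_norm_sq, EuclideanSpace.inner_eq_star_dotProduct, star_trivial]
  rw [h2]; linarith

/-- A positive definite quadratic form is bounded below by a multiple of the squared norm; the
constant comes from the largest eigenvalue of `-P`. -/
theorem Matrix.PosDef.exists_mul_sq_norm_le {n : ℕ} {P : Matrix (Fin n) (Fin n) ℝ}
    (hP : P.PosDef) : ∃ a : ℝ, 0 < a ∧
      ∀ x : EuclideanSpace ℝ (Fin n), a * ‖x‖ ^ 2 ≤ x.ofLp ⬝ᵥ (P *ᵥ x.ofLp) := by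
  rcases Nat.eq_zero_or_pos n with rfl | hn
  · exact ⟨1, one_pos, fun x => by simp [Subsingleton.elim x 0]⟩
  have : Nonempty (Fin n) := ⟨⟨0, hn⟩⟩
  have hmem : lambdaMax (-P) ∈ spectrum ℝ (-P) := by
    refine Set.Nonempty.csSup_mem ?_ Matrix.finite_real_spectrum
    exact ⟨_, hP.1.neg.eigenvalues_mem_spectrum_real ⟨0, hn⟩⟩
  rw [← spectrum.neg_eq, Set.mem_neg, hP.1.spectrum_real_eq_range_eigenvalues] at hmem
  obtain ⟨i, hi⟩ := hmem
  refine ⟨-lambdaMax (-P), hi ▸ hP.eigenvalues_pos i, fun x => ?_⟩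
  have := dotProduct_mulVec_le_lambdaMax hP.1.neg x
  rw [Matrix.neg_mulVec, dotProduct_neg] at this
  linarith

theorem weightedNorm_nonneg {n : ℕ} (P : Matrix (Fin n) (Fin n) ℝ)
    (x : EuclideanSpace ℝ (Fin n)) : 0 ≤ weightedNorm P x := Real.sqrt_nonneg _

theorem weightedNorm_zero {n : ℕ} (P : Matrix (Fin n) (Fin n) ℝ) : weightedNorm P 0 = 0 := by
  simp [weightedNorm]

theorem sq_weightedNorm {n : ℕ} {P : Matrix (Fin n) (Fin n) ℝ} (hP : P.PosSemidef)
    (x : EuclideanSpace ℝ (Fin n)) : weightedNorm P x ^ 2 = x.ofLp ⬝ᵥ (P *ᵥ x.ofLp) :=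
  Real.sq_sqrt (by simpa using hP.dotProduct_mulVec_nonneg x.ofLp)

open scoped MatrixOrder Matrix.Norms.L2Operator in
/-- A weighted norm is the Euclidean norm composed with a linear map. -/
theorem exists_weightedNorm_eq_norm {n : ℕ} {P : Matrix (Fin n) (Fin n) ℝ} (hP : P.PosSemidef) :
    ∃ R : Matrix (Fin n) (Fin n) ℝ, ∀ x, weightedNorm P x = ‖Matrix.toEuclideanLin R x‖ := by
  obtain ⟨R, rfl⟩ := CStarAlgebra.nonneg_iff_eq_star_mul_self.mp hP.nonneg
  refine ⟨R, fun x => ?_⟩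
  rw [weightedNorm, norm_eq_sqrt_real_inner, EuclideanSpace.inner_eq_star_dotProduct,
    Matrix.ofLp_toLpLin, Matrix.toLin'_apply, ← Matrix.mulVec_mulVec, Matrix.dotProduct_mulVec,
    Matrix.star_eq_conjTranspose, Matrix.vecMul_conjTranspose]
  simp only [star_trivial]

theorem weightedNorm_add_le {n : ℕ} {P : Matrix (Fin n) (Fin n) ℝ} (hP : P.PosSemidef)
    (x y : EuclideanSpace ℝ (Fin n)) :
    weightedNorm P (x + y) ≤ weightedNorm P x + weightedNorm P y := by
  obtain ⟨R, hR⟩ := exists_weightedNorm_eq_norm hP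
  simp only [hR, map_add]
  exact norm_add_le _ _

theorem weightedNorm_neg {n : ℕ} (P : Matrix (Fin n) (Fin n) ℝ) (x : EuclideanSpace ℝ (Fin n)) :
    weightedNorm P (-x) = weightedNorm P x := by
  simp [weightedNorm, Matrix.mulVec_neg]

theorem continuous_weightedNorm {n : ℕ} (P : Matrix (Fin n) (Fin n) ℝ) :
    Continuous (weightedNorm P) := by
  unfold weightedNorm; fun_prop

theorem weightedNorm_eq_zero_iff {n : ℕ} {P : Matrix (Fin n) (Fin n) ℝ} (hP : P.PosDef)
    {x : EuclideanSpace ℝ (Fin n)} : weightedNorm P x = 0 ↔ x = 0 := by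
  refine ⟨fun h => ?_, fun h => h ▸ weightedNorm_zero P⟩
  by_contra hx
  have h1 := hP.dotProduct_mulVec_pos (x := x.ofLp) (by simpa using hx)
  rw [star_trivial, ← sq_weightedNorm hP.posSemidef, h] at h1
  simp at h1

theorem sq_weightedNorm_toEuclideanLin {m n : ℕ} {P : Matrix (Fin n) (Fin n) ℝ}
    (hP : P.PosSemidef) (G : Matrix (Fin n) (Fin m) ℝ) (x : EuclideanSpace ℝ (Fin m)) :
    weightedNorm P (Matrix.toEuclideanLin G x) ^ 2 = x.ofLp ⬝ᵥ ((Gᵀ * P * G) *ᵥ x.ofLp) := by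
  rw [sq_weightedNorm hP, Matrix.ofLp_toLpLin, Matrix.toLin'_apply, Matrix.mul_assoc,
    ← Matrix.mulVec_mulVec, ← Matrix.mulVec_mulVec, Matrix.dotProduct_mulVec x.ofLp,
    Matrix.vecMul_transpose]

theorem weightedNorm_toEuclideanLin_le {m n : ℕ} {P : Matrix (Fin n) (Fin n) ℝ}
    (hP : P.PosSemidef) (G : Matrix (Fin n) (Fin m) ℝ) (x : EuclideanSpace ℝ (Fin m)) :
    weightedNorm P (Matrix.toEuclideanLin G x) ≤ √(lambdaMax (Gᵀ * P * G)) * ‖x‖ := by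
  have h := dotProduct_mulVec_le_lambdaMax (hP.conjTranspose_mul_mul_same G).1 x
  rw [Matrix.conjTranspose_eq_transpose_of_trivial, ← sq_weightedNorm_toEuclideanLin hP] at h
  calc _ = √(weightedNorm P (Matrix.toEuclideanLin G x) ^ 2) :=
        (Real.sqrt_sq (weightedNorm_nonneg _ _)).symm
    _ ≤ √(lambdaMax (Gᵀ * P * G) * ‖x‖ ^ 2) := Real.sqrt_le_sqrt h
    _ = _ := by rw [Real.sqrt_mul' _ (sq_nonneg _), Real.sqrt_sq (norm_nonneg _)]

theorem sqrt_lambdaMax_pos {m n : ℕ} {P : Matrix (Fin n) (Fin n) ℝ}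
    (hP : P.PosDef) {G : Matrix (Fin n) (Fin m) ℝ} (hG : G ≠ 0) :
    0 < √(lambdaMax (Gᵀ * P * G)) := by
  have hG' : Matrix.toEuclideanLin G ≠ 0 := by simpa using hG
  obtain ⟨x, hx⟩ : ∃ x, Matrix.toEuclideanLin G x ≠ 0 := by
    by_contra! h; exact hG' (LinearMap.ext h)
  have h1 : 0 < weightedNorm P (Matrix.toEuclideanLin G x) :=
    (weightedNorm_nonneg _ _).lt_of_ne' fun h => hx ((weightedNorm_eq_zero_iff hP).1 h)
  exact pos_of_mul_pos_left (h1.trans_le (weightedNorm_toEuclideanLin_le hP.posSemidef G x))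
    (norm_nonneg _)

theorem Matrix.PosDef.exists_mul_norm_le_weightedNorm {n : ℕ} {P : Matrix (Fin n) (Fin n) ℝ}
    (hP : P.PosDef) : ∃ a₁ a₂ : ℝ, 0 < a₁ ∧ 0 < a₂ ∧
      ∀ x, a₁ * ‖x‖ ≤ weightedNorm P x ∧ weightedNorm P x ≤ a₂ * ‖x‖ := by
  obtain ⟨a, ha, h⟩ := hP.exists_mul_sq_norm_le
  refine ⟨√a, √(lambdaMax P) + 1, Real.sqrt_pos.2 ha, by positivity, fun x => ⟨?_, ?_⟩⟩
  · refine Real.le_sqrt_of_sq_le ?_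
    rw [mul_pow, Real.sq_sqrt ha.le]; exact h x
  · have h1 := weightedNorm_toEuclideanLin_le hP.posSemidef 1 x
    rw [Matrix.transpose_one, one_mul, mul_one, Matrix.toLpLin_one] at h1
    exact h1.trans (by gcongr; simp)

theorem weightedOpNorm_nonneg {n : ℕ} (P M : Matrix (Fin n) (Fin n) ℝ) :
    0 ≤ weightedOpNorm P M := Real.sInf_nonneg fun _ hc => hc.1

theorem weightedOpNorm_le {n : ℕ} {P M : Matrix (Fin n) (Fin n) ℝ} {c : ℝ} (hc : 0 ≤ c)
    (h : ∀ x, weightedNorm P (Matrix.toEuclideanLin M x) ≤ c * weightedNorm P x) :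
    weightedOpNorm P M ≤ c :=
  csInf_le ⟨0, fun _ hc => hc.1⟩ ⟨hc, h⟩

/-- The infimum defining the induced norm is attained. -/
theorem weightedNorm_le_weightedOpNorm_mul {n : ℕ} {P M : Matrix (Fin n) (Fin n) ℝ} (hP : P.PosDef)
    (x : EuclideanSpace ℝ (Fin n)) :
    weightedNorm P (Matrix.toEuclideanLin M x) ≤ weightedOpNorm P M * weightedNorm P x := by
  rcases eq_or_ne x 0 with rfl | hx
  · simp [weightedNorm_zero]
  have hpos : 0 < weightedNorm P x :=
    (weightedNorm_nonneg _ _).lt_of_ne' fun h => hx ((weightedNorm_eq_zero_iff hP).1 h)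
  rw [← div_le_iff₀ hpos]
  obtain ⟨a₁, a₂, ha₁, ha₂, hb⟩ := hP.exists_mul_norm_le_weightedNorm
  refine le_csInf ?_ fun c hc => (div_le_iff₀ hpos).2 (hc.2 x)
  -- the set of admissible constants is nonempty
  refine ⟨√(lambdaMax (Mᵀ * P * M)) / a₁, by positivity, fun z => ?_⟩
  calc _ ≤ √(lambdaMax (Mᵀ * P * M)) * ‖z‖ := weightedNorm_toEuclideanLin_le hP.posSemidef M z
    _ = √(lambdaMax (Mᵀ * P * M)) / a₁ * (a₁ * ‖z‖) := by field_simp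
    _ ≤ _ := by gcongr; exact (hb z).1

/-- The Lyapunov equation gives `‖M x‖_P² = ‖x‖_P² - xᵀ Q x`, and `xᵀ Q x` is at least a fixed
fraction of `‖x‖_P²`. -/
theorem weightedOpNorm_lt_one {n : ℕ} {P Q M : Matrix (Fin n) (Fin n) ℝ} (hP : P.PosDef)
    (hQ : Q.PosDef) (h : Mᵀ * P * M = P - Q) : weightedOpNorm P M < 1 := by
  obtain ⟨q, hq, hQb⟩ := hQ.exists_mul_sq_norm_le
  obtain ⟨a₁, a₂, ha₁, ha₂, hb⟩ := hP.exists_mul_norm_le_weightedNorm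
  have hlt : √(1 - q / a₂ ^ 2) < 1 := by
    rw [Real.sqrt_lt' one_pos]
    have : 0 < q / a₂ ^ 2 := by positivity
    linarith
  refine (weightedOpNorm_le (Real.sqrt_nonneg _) fun x => ?_).trans_lt hlt
  rw [← Real.sqrt_sq (weightedNorm_nonneg P (Matrix.toEuclideanLin M x)),
    ← Real.sqrt_sq (weightedNorm_nonneg P x), ← Real.sqrt_mul' _ (sq_nonneg _)]
  refine Real.sqrt_le_sqrt ?_
  rw [sq_weightedNorm_toEuclideanLin hP.posSemidef, h, Matrix.sub_mulVec, dotProduct_sub,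
    ← sq_weightedNorm hP.posSemidef]
  have h1 : weightedNorm P x ^ 2 ≤ (a₂ * ‖x‖) ^ 2 :=
    pow_le_pow_left₀ (weightedNorm_nonneg _ _) (hb x).2 2
  have h2 : q / a₂ ^ 2 * weightedNorm P x ^ 2 ≤ q * ‖x‖ ^ 2 := by
    calc _ ≤ q / a₂ ^ 2 * (a₂ * ‖x‖) ^ 2 := by gcongr
      _ = _ := by field_simp
  linarith [hQb x]

/-! ### Time-discounted i-IOSS from linear gains -/

theorem classK_linGain {c : ℝ} (hc : 0 < c) : ClassK (linGain c) where
  continuous := by unfold linGain; fun_prop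
  strictMono := fun r s h => mul_lt_mul_of_pos_left h (Real.toNNReal_pos.2 hc)
  zero := mul_zero _

theorem coe_linGain {c : ℝ} (hc : 0 ≤ c) (r : ℝ≥0) : (linGain c r : ℝ) = c * r := by
  rw [linGain, NNReal.coe_mul, Real.coe_toNNReal _ hc]

/-- Exponentially discounted linear gains are of class `𝒦ℒ`. -/
theorem classKL_mul_pow_mul {c q : ℝ≥0} (hc : 0 < c) (hq : 0 < q) (hq1 : q < 1) :
    ClassKL fun r t => c * q ^ t * r where
  classK t :=
    { continuous := by fun_prop
      strictMono := fun r s h => mul_lt_mul_of_pos_left h (by positivity)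
      zero := mul_zero _ }
  classL r :=
    { antitone := fun s t h => by
        have := pow_le_pow_of_le_one zero_le hq1.le h
        dsimp only
        gcongr
      tendsto_zero := by
        have := ((NNReal.tendsto_pow_atTop_nhds_zero_of_lt_one hq1).const_mul c).mul_const r
        simpa using this }

theorem ClassKL.apply_zero {β : ℝ≥0 → ℕ → ℝ≥0} (hβ : ClassKL β) (t : ℕ) : β 0 t = 0 :=
  (hβ.classK t).zero

/-- Constants for `le_mul_of_le_mul_add`: `q` is any number in `(c, 1)` and `k = q / (q - c)`. -/
theorem exists_discount {c : ℝ≥0} (hc : c < 1) :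
    ∃ q k : ℝ≥0, 0 < q ∧ q < 1 ∧ 1 ≤ k ∧ q + c * k = q * k := by
  obtain ⟨q, hcq, hq1⟩ := exists_between hc
  obtain ⟨d, rfl⟩ := exists_add_of_le hcq.le
  have hd : 0 < d := pos_of_lt_add_right hcq
  refine ⟨c + d, (c + d) / d, pos_of_gt hcq, hq1, ?_, ?_⟩
  · rw [one_le_div hd]; exact le_add_self
  · rw [add_mul c d, mul_div_cancel₀ _ hd.ne', add_comm]

/-- A scalar recursion `W(t+1) ≤ c W(t) + a(t)` with `c < 1`, solved in max-form: the sum over the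
past inputs becomes a maximum at the price of a slower discount rate `q > c` and a constant `k`. -/
theorem le_mul_of_le_mul_add {c q k : ℝ≥0} (hq : 0 < q) (hk1 : 1 ≤ k)
    (hk : q + c * k = q * k) {W a : ℕ → ℝ≥0} (hW : ∀ t, W (t + 1) ≤ c * W t + a t)
    (t : ℕ) (m : ℝ≥0) (h0 : q ^ t * W 0 ≤ m)
    (ha : ∀ s < t, q ^ s * a (t - (s + 1)) ≤ m) : W t ≤ k * m := by
  induction t generalizing m with
  | zero =>
    rw [pow_zero, one_mul] at h0
    exact h0.trans (le_mul_of_one_le_left zero_le hk1)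
  | succ t ih =>
    -- one step earlier, the discounted data are bounded by `m / q`
    obtain ⟨m', rfl⟩ : ∃ m', m = q * m' := ⟨m / q, (mul_div_cancel₀ _ hq.ne').symm⟩
    have h1 : W t ≤ k * m' := by
      refine ih m' ?_ fun s hs => ?_
      · rw [pow_succ', mul_assoc] at h0
        exact le_of_mul_le_mul_left h0 hq
      · have := ha (s + 1) (by omega)
        rw [pow_succ', mul_assoc, Nat.add_sub_add_right] at this
        exact le_of_mul_le_mul_left this hq
    have h2 : a t ≤ q * m' := by simpa using ha 0 (by omega)
    calc W (t + 1) ≤ c * W t + a t := hW t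
      _ ≤ c * (k * m') + q * m' := by gcongr
      _ = (q + c * k) * m' := by ring
      _ = k * (q * m') := by rw [hk]; ring

/-- A Lyapunov function that is equivalent to the distance and has linear gains yields
time-discounted i-IOSS, with exponential discounting. -/
theorem LyapunovCondition.timeDiscountedIIOSS_of_linGain {X U W V Y : Type*}
    [MetricSpace X] [MetricSpace U] [MetricSpace W] [MetricSpace V] [MetricSpace Y]
    {f : X → U → W → X} {h : X → U → V → Y} {S : X × X → ℝ} {a₁ a₂ η gw gv gu gy : ℝ}
    (ha₁ : 0 < a₁) (ha₂ : 0 < a₂) (hη : 0 < η) (hη1 : η ≤ 1)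
    (hS : LyapunovCondition f h S (linGain a₁) (linGain a₂) (linGain η)
      (linGain gw) (linGain gv) (linGain gu) (linGain gy)) : TimeDiscountedIIOSS f h := by
  have hS0 : ∀ x χ, 0 ≤ S (x, χ) := fun x χ => (NNReal.coe_nonneg _).trans (hS.lower x χ)
  obtain ⟨q, k, hq, hq1, hk1, hk⟩ :=
    exists_discount (c := (1 - η).toNNReal) (by rw [Real.toNNReal_lt_one]; linarith)
  -- a common gain for the four inputs
  let b : ℝ≥0 := gw.toNNReal + gv.toNNReal + gu.toNNReal + gy.toNNReal + 1
  have hb : 0 < b := by positivity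
  lift a₁ to ℝ≥0 using ha₁.le
  lift a₂ to ℝ≥0 using ha₂.le
  rw [NNReal.coe_pos] at ha₁ ha₂
  have hkpos : 0 < k := one_pos.trans_le hk1
  have hG := classKL_mul_pow_mul (c := a₁⁻¹ * k * b * q⁻¹) (by positivity) hq hq1
  refine ⟨fun r t => a₁⁻¹ * k * a₂ * q ^ t * r, _, _, _, _,
    classKL_mul_pow_mul (by positivity) hq hq1, hG, hG, hG, hG, ?_⟩
  intro x χ u υ w ω v ν y ζ hx hχ t
  dsimp only
  set R : ℝ≥0 := max _ _ with hR
  let a : ℕ → ℝ≥0 := fun t => b * max (nndist (w t) (ω t)) (max (nndist (v t) (ν t))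
    (max (nndist (u t) (υ t)) (nndist (y t) (ζ t))))
  have hrec : ∀ t, (S (x (t + 1), χ (t + 1))).toNNReal ≤
      (1 - η).toNNReal * (S (x t, χ t)).toNNReal + a t := fun t => by
    have h1 := hS.decrease (x t) (χ t) (u t) (υ t) (w t) (ω t) (v t) (ν t)
    rw [← hx.state, ← hχ.state, ← hx.output, ← hχ.output, coe_linGain hη.le,
      Real.coe_toNNReal _ (hS0 _ _)] at h1
    have h2 : linGain gw (nndist (w t) (ω t)) + linGain gv (nndist (v t) (ν t)) +
        linGain gu (nndist (u t) (υ t)) + linGain gy (nndist (y t) (ζ t)) ≤ a t := by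
      simp only [linGain, a, b, add_mul, one_mul]
      refine le_add_right ?_
      gcongr <;> simp
    rw [← NNReal.coe_le_coe] at h2 ⊢
    push_cast at h2 ⊢
    rw [Real.coe_toNNReal _ (hS0 _ _), Real.coe_toNNReal _ (hS0 _ _),
      Real.coe_toNNReal _ (sub_nonneg.2 hη1)]
    linarith
  have hW := le_mul_of_le_mul_add (W := fun t => (S (x t, χ t)).toNNReal) hq hk1 hk hrec t
    (a₁ * k⁻¹ * R) ?_ ?_
  · have h1 := hS.lower (x t) (χ t)
    rw [coe_linGain (NNReal.coe_nonneg a₁)] at h1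
    have h2 : a₁ * nndist (x t) (χ t) ≤ (S (x t, χ t)).toNNReal := by
      rw [← NNReal.coe_le_coe, Real.coe_toNNReal _ (hS0 _ _)]
      exact_mod_cast h1
    refine le_of_mul_le_mul_left (h2.trans (hW.trans_eq ?_)) ha₁
    field_simp
  · have h1 : (S (x 0, χ 0)).toNNReal ≤ a₂ * nndist (x 0) (χ 0) := by
      have := hS.upper (x 0) (χ 0)
      rw [coe_linGain (NNReal.coe_nonneg a₂)] at this
      rw [← NNReal.coe_le_coe, Real.coe_toNNReal _ (hS0 _ _)]
      exact_mod_cast this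
    calc _ ≤ q ^ t * (a₂ * nndist (x 0) (χ 0)) := by gcongr
      _ = a₁ * k⁻¹ * (a₁⁻¹ * k * a₂ * q ^ t * nndist (x 0) (χ 0)) := by field_simp
      _ ≤ _ := by gcongr; exact le_max_left _ _
  · intro s hs
    have hmem : s + 1 ∈ Finset.Icc 1 t := Finset.mem_Icc.2 ⟨by omega, by omega⟩
    have h1 := (Finset.le_sup (f := fun τ =>
      max (a₁⁻¹ * k * b * q⁻¹ * q ^ τ * nndist (w (t - τ)) (ω (t - τ)))
        (max (a₁⁻¹ * k * b * q⁻¹ * q ^ τ * nndist (v (t - τ)) (ν (t - τ)))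
          (max (a₁⁻¹ * k * b * q⁻¹ * q ^ τ * nndist (u (t - τ)) (υ (t - τ)))
            (a₁⁻¹ * k * b * q⁻¹ * q ^ τ * nndist (y (t - τ)) (ζ (t - τ)))))) hmem).trans
      (le_max_right (a₁⁻¹ * k * a₂ * q ^ t * nndist (x 0) (χ 0)) _)
    rw [← hR] at h1
    simp only [← mul_max_of_nonneg _ _ (zero_le (a := a₁⁻¹ * k * b * q⁻¹ * q ^ (s + 1)))] at h1
    calc _ = a₁ * k⁻¹ * (a₁⁻¹ * k * b * q⁻¹ * q ^ (s + 1) * _) := by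
          simp only [a]; rw [pow_succ]; field_simp
      _ ≤ _ := mul_le_mul_right h1 _

/-! ### Linear systems -/

/-- Necessity of detectability: a trajectory with zero inputs and zero output is compared with the
zero solution. -/
theorem TimeDiscountedIIOSS.detectable {nx nu nw nv ny : ℕ}
    {A : Matrix (Fin nx) (Fin nx) ℝ} {B : Matrix (Fin nx) (Fin nu) ℝ}
    {E : Matrix (Fin nx) (Fin nw) ℝ} {C : Matrix (Fin ny) (Fin nx) ℝ}
    {D : Matrix (Fin ny) (Fin nu) ℝ} {F : Matrix (Fin ny) (Fin nv) ℝ}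
    (h : TimeDiscountedIIOSS (linState A B E) (linOutput C D F)) : Detectable A C := by
  intro x hx hC
  obtain ⟨β, γ, δ, ε, φ, hβ, hγ, hδ, hε, hφ, h⟩ := h
  have hbound : ∀ t, nndist (x t) 0 ≤ β (nndist (x 0) 0) t := fun t => by
    have := h x (fun _ => 0) (fun _ => 0) (fun _ => 0) (fun _ => 0) (fun _ => 0) (fun _ => 0)
      (fun _ => 0) (fun _ => 0) (fun _ => 0)
      ⟨fun t => by simp [linState, hx], fun t => by simp [linOutput, hC]⟩
      ⟨fun t => by simp [linState], fun t => by simp [linOutput]⟩ t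
    simpa [hγ.apply_zero, hδ.apply_zero, hε.apply_zero, hφ.apply_zero, Finset.sup_le_iff] using this
  rw [tendsto_iff_dist_tendsto_zero]
  refine squeeze_zero (fun _ => dist_nonneg) (fun t => ?_)
    (NNReal.tendsto_coe.2 ((hβ.classL (nndist (x 0) 0)).tendsto_zero))
  exact_mod_cast hbound t

/-- One step of the error dynamics, rewritten with the output injection `L`. -/
theorem weightedNorm_sub_linState_le {nx nu nw nv ny : ℕ}
    (A : Matrix (Fin nx) (Fin nx) ℝ) (B : Matrix (Fin nx) (Fin nu) ℝ)
    (E : Matrix (Fin nx) (Fin nw) ℝ) (C : Matrix (Fin ny) (Fin nx) ℝ)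
    (D : Matrix (Fin ny) (Fin nu) ℝ) (F : Matrix (Fin ny) (Fin nv) ℝ)
    (L : Matrix (Fin nx) (Fin ny) ℝ) {P : Matrix (Fin nx) (Fin nx) ℝ} (hP : P.PosDef)
    (x χ : EuclideanSpace ℝ (Fin nx)) (u υ : EuclideanSpace ℝ (Fin nu))
    (w ω : EuclideanSpace ℝ (Fin nw)) (v ν : EuclideanSpace ℝ (Fin nv)) :
    weightedNorm P (linState A B E x u w - linState A B E χ υ ω) ≤
      weightedOpNorm P (A + L * C) * weightedNorm P (x - χ)
      + √(lambdaMax (Eᵀ * P * E)) * ‖w - ω‖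
      + √(lambdaMax ((L * F)ᵀ * P * (L * F))) * ‖v - ν‖
      + √(lambdaMax ((B + L * D)ᵀ * P * (B + L * D))) * ‖u - υ‖
      + √(lambdaMax (Lᵀ * P * L)) * ‖linOutput C D F x u v - linOutput C D F χ υ ν‖ := by
  -- output injection: the difference of the outputs is added and subtracted through `L`
  have key : linState A B E x u w - linState A B E χ υ ω =
      Matrix.toEuclideanLin (A + L * C) (x - χ) + Matrix.toEuclideanLin E (w - ω)
      + Matrix.toEuclideanLin (L * F) (v - ν) + Matrix.toEuclideanLin (B + L * D) (u - υ)
      + -Matrix.toEuclideanLin L (linOutput C D F x u v - linOutput C D F χ υ ν) := by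
    simp only [linState, linOutput, map_add, map_sub, LinearMap.add_apply, Matrix.toLpLin_mul_same,
      LinearMap.comp_apply]
    abel
  have hP' := hP.posSemidef
  rw [key]
  refine (weightedNorm_add_le hP' _ _).trans (add_le_add ?_ ?_)
  · refine (weightedNorm_add_le hP' _ _).trans
      (add_le_add ?_ (weightedNorm_toEuclideanLin_le hP' _ _))
    refine (weightedNorm_add_le hP' _ _).trans
      (add_le_add ?_ (weightedNorm_toEuclideanLin_le hP' _ _))
    exact (weightedNorm_add_le hP' _ _).trans (add_le_add (weightedNorm_le_weightedOpNorm_mul hP _)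
      (weightedNorm_toEuclideanLin_le hP' _ _))
  · rw [weightedNorm_neg]
    exact weightedNorm_toEuclideanLin_le hP' _ _

/-- The weighted norm of the difference satisfies the Lyapunov inequalities with any linear input
gains dominating the square roots of the largest eigenvalues. Larger gains are allowed because
those of the vanishing matrices are not of class `𝒦`. -/
theorem lyapunovCondition_weightedNorm {nx nu nw nv ny : ℕ}
    (A : Matrix (Fin nx) (Fin nx) ℝ) (B : Matrix (Fin nx) (Fin nu) ℝ)
    (E : Matrix (Fin nx) (Fin nw) ℝ) (C : Matrix (Fin ny) (Fin nx) ℝ)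
    (D : Matrix (Fin ny) (Fin nu) ℝ) (F : Matrix (Fin ny) (Fin nv) ℝ)
    (L : Matrix (Fin nx) (Fin ny) ℝ) {P : Matrix (Fin nx) (Fin nx) ℝ} (hP : P.PosDef)
    (hlt : weightedOpNorm P (A + L * C) < 1) {a₁ a₂ gw gv gu gy : ℝ} (ha₁ : 0 < a₁) (ha₂ : 0 < a₂)
    (hb : ∀ x, a₁ * ‖x‖ ≤ weightedNorm P x ∧ weightedNorm P x ≤ a₂ * ‖x‖)
    (hw : √(lambdaMax (Eᵀ * P * E)) ≤ gw) (hv : √(lambdaMax ((L * F)ᵀ * P * (L * F))) ≤ gv)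
    (hu : √(lambdaMax ((B + L * D)ᵀ * P * (B + L * D))) ≤ gu)
    (hy : √(lambdaMax (Lᵀ * P * L)) ≤ gy) :
    LyapunovCondition (linState A B E) (linOutput C D F)
      (fun p => weightedNorm P (p.1 - p.2)) (linGain a₁) (linGain a₂)
      (linGain (1 - weightedOpNorm P (A + L * C)))
      (linGain gw) (linGain gv) (linGain gu) (linGain gy) where
  lower x χ := by
    rw [coe_linGain ha₁.le, coe_nndist, dist_eq_norm]; exact (hb _).1
  upper x χ := by
    rw [coe_linGain ha₂.le, coe_nndist, dist_eq_norm]; exact (hb _).2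
  decrease x χ u υ w ω v ν := by
    have hs := fun M : ℝ => Real.sqrt_nonneg M
    rw [coe_linGain (sub_nonneg.2 hlt.le), coe_linGain ((hs _).trans hw),
      coe_linGain ((hs _).trans hv), coe_linGain ((hs _).trans hu), coe_linGain ((hs _).trans hy),
      Real.coe_toNNReal _ (weightedNorm_nonneg _ _)]
    simp only [coe_nndist, dist_eq_norm]
    refine (weightedNorm_sub_linState_le A B E C D F L hP x χ u υ w ω v ν).trans ?_
    have e : ∀ c s : ℝ, s - (1 - c) * s = c * s := fun c s => by ring
    rw [e]
    gcongr

theorem Detectable.exists_schurStable_posDef {nx ny : ℕ} {A : Matrix (Fin nx) (Fin nx) ℝ}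
    {C : Matrix (Fin ny) (Fin nx) ℝ} (h : Detectable A C) :
    ∃ (L : Matrix (Fin nx) (Fin ny) ℝ) (P Q : Matrix (Fin nx) (Fin nx) ℝ),
      SchurStable (A + L * C) ∧ P.PosDef ∧ Q.PosDef ∧
      (A + L * C)ᵀ * P * (A + L * C) = P - Q := by
  obtain ⟨L, hL⟩ := h.exists_tendsto_pow_zero
  obtain ⟨P, Q, hP, hQ, hPQ⟩ := Matrix.exists_posDef_lyapunov_of_tendsto_pow_zero hL
  exact ⟨L, P, Q, .of_tendsto_pow_zero hL, hP, hQ, hPQ⟩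

theorem mainTheorem1 {nx nu nw nv ny : ℕ}
    (A : Matrix (Fin nx) (Fin nx) ℝ) (B : Matrix (Fin nx) (Fin nu) ℝ)
    (E : Matrix (Fin nx) (Fin nw) ℝ) (C : Matrix (Fin ny) (Fin nx) ℝ)
    (D : Matrix (Fin ny) (Fin nu) ℝ) (F : Matrix (Fin ny) (Fin nv) ℝ) :
    (Detectable A C ↔ TimeDiscountedIIOSS (linState A B E) (linOutput C D F)) ∧
    (Detectable A C → ∃ (L : Matrix (Fin nx) (Fin ny) ℝ) (P Q : Matrix (Fin nx) (Fin nx) ℝ),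
      SchurStable (A + L * C) ∧ P.PosDef ∧ Q.PosDef ∧
      (A + L * C)ᵀ * P * (A + L * C) = P - Q) ∧
    (∀ (L : Matrix (Fin nx) (Fin ny) ℝ) (P Q : Matrix (Fin nx) (Fin nx) ℝ),
      P.PosDef → Q.PosDef → (A + L * C)ᵀ * P * (A + L * C) = P - Q →
      weightedOpNorm P (A + L * C) < 1 ∧
      (∃ a₁ a₂ : ℝ, 0 < a₁ ∧ 0 < a₂ ∧
        LyapunovCondition (linState A B E) (linOutput C D F)
          (fun p => weightedNorm P (p.1 - p.2))
          (linGain a₁) (linGain a₂)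
          (linGain (1 - weightedOpNorm P (A + L * C)))
          (linGain √(lambdaMax (Eᵀ * P * E)))
          (linGain √(lambdaMax ((L * F)ᵀ * P * (L * F))))
          (linGain √(lambdaMax ((B + L * D)ᵀ * P * (B + L * D))))
          (linGain √(lambdaMax (Lᵀ * P * L)))) ∧
      (E ≠ 0 → ClassK (linGain √(lambdaMax (Eᵀ * P * E)))) ∧
      (L * F ≠ 0 → ClassK (linGain √(lambdaMax ((L * F)ᵀ * P * (L * F))))) ∧
      (B + L * D ≠ 0 → ClassK (linGain √(lambdaMax ((B + L * D)ᵀ * P * (B + L * D))))) ∧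
      (L ≠ 0 → ClassK (linGain √(lambdaMax (Lᵀ * P * L)))) ∧
      IsIIOSSLyapunovFunction (linState A B E) (linOutput C D F)
        (fun p => weightedNorm P (p.1 - p.2)) ∧
      TimeDiscountedIIOSS (linState A B E) (linOutput C D F)) := by
  
  have hiss : ∀ (L : Matrix (Fin nx) (Fin ny) ℝ) (P Q : Matrix (Fin nx) (Fin nx) ℝ),
      P.PosDef → Q.PosDef → (A + L * C)ᵀ * P * (A + L * C) = P - Q →
      TimeDiscountedIIOSS (linState A B E) (linOutput C D F) := fun L P Q hP hQ h => by
    obtain ⟨a₁, a₂, ha₁, ha₂, hb⟩ := hP.exists_mul_norm_le_weightedNorm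
    have hlt := weightedOpNorm_lt_one hP hQ h
    exact (lyapunovCondition_weightedNorm A B E C D F L hP hlt ha₁ ha₂ hb le_rfl le_rfl le_rfl
      le_rfl).timeDiscountedIIOSS_of_linGain ha₁ ha₂ (sub_pos.2 hlt)
      (sub_le_self _ (weightedOpNorm_nonneg _ _))
  refine ⟨⟨fun h => ?_, fun h => h.detectable⟩, fun h => h.exists_schurStable_posDef,
    fun L P Q hP hQ h => ?_⟩
  · obtain ⟨L, P, Q, -, hP, hQ, hPQ⟩ := h.exists_schurStable_posDef
    exact hiss L P Q hP hQ hPQ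
  · obtain ⟨a₁, a₂, ha₁, ha₂, hb⟩ := hP.exists_mul_norm_le_weightedNorm
    have hlt := weightedOpNorm_lt_one hP hQ h
    refine ⟨hlt, ⟨a₁, a₂, ha₁, ha₂, lyapunovCondition_weightedNorm A B E C D F L hP hlt ha₁ ha₂ hb
        le_rfl le_rfl le_rfl le_rfl⟩,
      fun hE => classK_linGain (sqrt_lambdaMax_pos hP hE),
      fun hF => classK_linGain (sqrt_lambdaMax_pos hP hF),
      fun hB => classK_linGain (sqrt_lambdaMax_pos hP hB),
      fun hL => classK_linGain (sqrt_lambdaMax_pos hP hL),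
      ⟨(continuous_weightedNorm P).comp (continuous_fst.sub continuous_snd), ?_⟩,
      hiss L P Q hP hQ h⟩
    -- gains enlarged by one are of class `𝒦` even when the corresponding matrix vanishes
    have hpos : ∀ M : ℝ, 0 < √M + 1 := fun M => by positivity
    have hle : ∀ M : ℝ, √M ≤ √M + 1 := fun M => (lt_add_one _).le
    exact ⟨_, _, _, _, _, _, _, classK_linGain ha₁, classK_linGain ha₂,
      classK_linGain (sub_pos.2 hlt), classK_linGain (hpos _), classK_linGain (hpos _),
      classK_linGain (hpos _), classK_linGain (hpos _),
      lyapunovCondition_weightedNorm A B E C D F L hP hlt ha₁ ha₂ hb (hle _) (hle _) (hle _) (hle _)⟩
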